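/- Let $I\subseteq\mathbb R$ be any non-degenerate interval (open, closed or half-open, bounded or unbounded), and let $f:I\to I$ be a continuous surjective map which is bitransitive, i.e. $f^2=f\circ f$ is topologically transitive: for all nonempty relatively open $U,V\subseteq I$ there is $k\ge 1$ with $f^{2k}(U)\cap V\neq\emptyset$. Then $f$ is topologically conjugate to a continuous map $g:I\to I$ which is extremely chaotic almost everywhere; that is, there are a homeomorphism $h:I\to I$ and a continuous map $g:I\to I$ with $h\circ f=g\circ h$ such that $g$ has an extremely scrambled set $S\subseteq I$ of full Lebesgue measure, i.e. with $I\setminus S$ of Lebesgue measure zero. Here a set $S\subseteq I$ with at least two points is called extremely scrambled for $g$ if there is $\beta\in(0,\infty]$ such that, for any two distinct points $x,y\in S$, $$\liminf_{n\to\infty}|g^n(x)-g^n(y)|=0\quad\text{and}\quad\limsup_{n\to\infty}|g^n(x)-g^n(y)|\ge\beta$$ (the upper limit being infinite if $\beta=\infty$), and if moreover, for any two distinct points $c,d\in S$ and any compact interval $K$ contained in the interior of $I$, there is an integer $n\ge1$ such that the closed interval with endpoints $g^n(c)$ and $g^n(d)$ contains $K$. -/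

import Mathlib

open Set Filter MeasureTheory
open scoped ENNReal

namespace IntervalDynamics

/-- Topological transitivity: for all nonempty open `U`, `V` there is `k ≥ 1` such that
`f^k(U)` meets `V`. -/
def IsTransitive {X : Type*} [TopologicalSpace X] (f : X → X) : Prop :=
  ∀ U V : Set X, IsOpen U → IsOpen V → U.Nonempty → V.Nonempty →
    ∃ k : ℕ, 1 ≤ k ∧ ((f^[k] '' U) ∩ V).Nonempty

/-- `f` is bitransitive if `f²` is transitive. -/
def IsBitransitive {X : Type*} [TopologicalSpace X] (f : X → X) : Prop :=
  IsTransitive (f^[2])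

/-- `f` and `g` are topologically conjugate: `h ∘ f = g ∘ h` for some homeomorphism `h`. -/
def TopConjugate {X Y : Type*} [TopologicalSpace X] [TopologicalSpace Y]
    (f : X → X) (g : Y → Y) : Prop :=
  ∃ h : X ≃ₜ Y, Function.Semiconj h f g

/-- `β`-scrambled sets. The distances are taken in `[0, ∞]`, so that the upper limit may be
infinite; for `β = ∞` the last condition says that it is infinite. -/
def IsScrambled {I : Set ℝ} (f : I → I) (β : ℝ≥0∞) (S : Set I) : Prop :=
  S.Nontrivial ∧
    ∀ x ∈ S, ∀ y ∈ S, x ≠ y →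
      liminf (fun n : ℕ => edist (f^[n] x) (f^[n] y)) atTop = 0 ∧
      β ≤ limsup (fun n : ℕ => edist (f^[n] x) (f^[n] y)) atTop

/-- Extremely scrambled sets: `S` is `β`-scrambled for some `0 < β ≤ ∞`, and for distinct
`c, d ∈ S` every compact interval in the interior of `I` is contained in the interval with
endpoints `f^n(c)` and `f^n(d)` for some `n ≥ 1`. -/
def IsExtremelyScrambled {I : Set ℝ} (f : I → I) (S : Set I) : Prop :=
  (∃ β : ℝ≥0∞, 0 < β ∧ IsScrambled f β S) ∧
    ∀ c ∈ S, ∀ d ∈ S, c ≠ d →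
      ∀ u v : ℝ, u < v → Icc u v ⊆ interior I →
        ∃ n : ℕ, 1 ≤ n ∧ Icc u v ⊆ uIcc (f^[n] c : ℝ) (f^[n] d : ℝ)

/-- `f` is extremely chaotic almost everywhere: it has an extremely scrambled set of full
Lebesgue measure in `I`. -/
def IsExtremelyChaoticAE {I : Set ℝ} (f : I → I) : Prop :=
  ∃ S : Set I, IsExtremelyScrambled f S ∧ volume (I \ (Subtype.val '' S)) = 0

end IntervalDynamics

/-! The core is that a bitransitive interval map is weakly mixing (`IsBitransitive.weakly_mixing`).
Periodic points are dense, so a periodic point leads from one open set to another along an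
arithmetic progression of times. A second pair of open sets must then be joined at a time in a
prescribed residue class (`IsBitransitive.exists_dvd_iterate_mem`). To see that this is possible,
group the images of a small interval by residue of the time: the closures are convex sets, mapped
cyclically and all containing a fixed point. Of three nondegenerate convex sets on a line with a
common point, two overlap, so only a cycle of length at most two could survive, and transitivity of
`f²` excludes it.

By weak mixing, the pairs that visit a given product of open sets after time `N` form a dense open
relation. By a Baire argument (`exists_generic_map`), a generic continuous map from a countable sum
of Cantor sets has dense range and satisfies countably many such relations at all pairs of distinct
points. The image of a diffuse measure of full support is again diffuse and of full support, and it
lives on a set `S` whose pairs have dense orbits (`IsBitransitive.exists_measure_hasDensePairs`).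

The distribution function of this measure is continuous and strictly increasing on `I`, and hence
yields a homeomorphism of `I` under which the complement of `S` becomes Lebesgue null
(`exists_homeomorph_null_image`). Density of pair orbits survives conjugacy and implies extreme
scrambling. -/

namespace IntervalDynamics

/-! ### Transitive maps and convex sets in a linear order -/

section Transitive

variable {X : Type*} [TopologicalSpace X] {f : X → X}

theorem IsTransitive.exists_iterate_mem (hf : IsTransitive f) {U V : Set X} (hU : IsOpen U)
    (hV : IsOpen V) (hU' : U.Nonempty) (hV' : V.Nonempty) :
    ∃ k : ℕ, 1 ≤ k ∧ ∃ x ∈ U, f^[k] x ∈ V := by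
  obtain ⟨k, hk, _, ⟨x, hx, rfl⟩, hxV⟩ := hf U V hU hV hU' hV'
  exact ⟨k, hk, x, hx, hxV⟩

/-- Transitivity of an iterate implies transitivity. -/
theorem IsTransitive.of_iterate {n : ℕ} (hn : 1 ≤ n) (hf : IsTransitive (f^[n])) :
    IsTransitive f := by
  intro U V hU hV hU' hV'
  obtain ⟨k, hk, h⟩ := hf U V hU hV hU' hV'
  rw [← Function.iterate_mul] at h
  exact ⟨n * k, Nat.mul_pos hn hk, h⟩

/-- Iterates of a transitive map have dense range. -/
theorem IsTransitive.preimage_iterate_nonempty (hf : IsTransitive f) (hc : Continuous f)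
    {V : Set X} (hV : IsOpen V) (hV' : V.Nonempty) (n : ℕ) :
    IsOpen (f^[n] ⁻¹' V) ∧ (f^[n] ⁻¹' V).Nonempty := by
  refine ⟨hV.preimage (hc.iterate n), ?_⟩
  induction n with
  | zero => simpa using hV'
  | succ n ih =>
    obtain ⟨k, hk, x, -, hx⟩ := hf.exists_iterate_mem isOpen_univ
      (hV.preimage (hc.iterate n)) ⟨hV'.some, trivial⟩ ih
    obtain ⟨k, rfl⟩ := Nat.exists_eq_add_of_le' hk
    refine ⟨f^[k] x, ?_⟩
    rw [mem_preimage, Function.iterate_succ_apply]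
    rwa [Function.iterate_succ_apply'] at hx

/-- A closed forward invariant set with nonempty interior is the whole space. -/
theorem IsTransitive.eq_univ (hf : IsTransitive f) {M : Set X} (hM : IsClosed M)
    (hint : (interior M).Nonempty) (hmaps : MapsTo f M M) : M = univ := by
  by_contra hne
  obtain ⟨k, -, x, hx, hxV⟩ := hf.exists_iterate_mem isOpen_interior hM.isOpen_compl hint
    (nonempty_compl.2 hne)
  exact hxV (hmaps.iterate k (interior_subset hx))

end Transitive

/-- Among three nondegenerate convex sets with a common point, two overlap. -/
theorem exists_overlap {X : Type*} [LinearOrder X] {c : X} {M : Fin 3 → Set X}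
    (hM : ∀ i, (M i).OrdConnected) (hM' : ∀ i, (M i).Nontrivial) (hc : ∀ i, c ∈ M i) :
    ∃ i j, i ≠ j ∧ (M i ∩ M j).Nontrivial := by
  classical
  -- Pigeonhole on whether a set reaches to the right of `c`; one that does not must reach to the
  -- left.
  obtain ⟨i, j, hij, hside⟩ : ∃ i j, i ≠ j ∧
      (decide (∃ x ∈ M i, c < x) = decide (∃ x ∈ M j, c < x)) := by
    have := Fintype.exists_ne_map_eq_of_card_lt
      (fun i : Fin 3 => decide (∃ x ∈ M i, c < x)) (by simp)
    simpa using this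
  refine ⟨i, j, hij, ?_⟩
  rw [decide_eq_decide] at hside
  by_cases h : ∃ x ∈ M i, c < x
  · obtain ⟨y, hy, hcy⟩ := hside.1 h
    obtain ⟨x, hx, hcx⟩ := h
    refine ⟨c, ⟨hc i, hc j⟩, min x y, ⟨?_, ?_⟩, (lt_min hcx hcy).ne⟩
    · exact (hM i).out (hc i) hx ⟨(lt_min hcx hcy).le, min_le_left _ _⟩
    · exact (hM j).out (hc j) hy ⟨(lt_min hcx hcy).le, min_le_right _ _⟩
  · have h' : ¬ ∃ x ∈ M j, c < x := fun h2 => h (hside.2 h2)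
    push Not at h h'
    obtain ⟨x, hx, hxc⟩ := (hM' i).exists_ne c
    obtain ⟨y, hy, hyc⟩ := (hM' j).exists_ne c
    have hx' := lt_of_le_of_ne (h x hx) hxc
    have hy' := lt_of_le_of_ne (h' y hy) hyc
    refine ⟨c, ⟨hc i, hc j⟩, max x y, ⟨?_, ?_⟩, (max_lt hx' hy').ne'⟩
    · exact (hM i).out hx (hc i) ⟨le_max_left _ _, (max_lt hx' hy').le⟩
    · exact (hM j).out hy (hc j) ⟨le_max_right _ _, (max_lt hx' hy').le⟩

section Order

variable {X : Type*} [LinearOrder X] [TopologicalSpace X] [OrderTopology X]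

/-- If a connected set `J` contains no periodic point and a point of `J` moves to the right within
`J` under `g`, it stays to the right of its starting point forever. -/
theorem lt_iterate_of_no_periodic {g : X → X} (hc : Continuous g) {J : Set X}
    (hJ : IsPreconnected J) (hno : ∀ x ∈ J, ∀ n, 1 ≤ n → g^[n] x ≠ x) {z : X} (hz : z ∈ J)
    (hgz : g z ∈ J) (hlt : z < g z) (k : ℕ) : z < g^[k + 1] z := by
  induction k with
  | zero => exact hlt
  | succ k ih =>
    by_contra! hle
    -- `g^[k + 1]` moves `z` to the right and `g z` to the left, so it fixes a point of `J`.
    rw [Function.iterate_succ_apply] at hle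
    obtain ⟨x, hx, hxe⟩ := hJ.intermediate_value₂ hgz hz (hc.iterate (k + 1)).continuousOn
      continuousOn_id (hle.trans hlt.le) ih.le
    exact hno x hx (k + 1) (Nat.succ_pos k) hxe

theorem iterate_lt_of_no_periodic {g : X → X} (hc : Continuous g) {J : Set X}
    (hJ : IsPreconnected J) (hno : ∀ x ∈ J, ∀ n, 1 ≤ n → g^[n] x ≠ x) {z : X} (hz : z ∈ J)
    (hgz : g z ∈ J) (hlt : g z < z) (k : ℕ) : g^[k + 1] z < z := by
  induction k with
  | zero => exact hlt
  | succ k ih =>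
    by_contra! hle
    rw [Function.iterate_succ_apply] at hle
    obtain ⟨x, hx, hxe⟩ := hJ.intermediate_value₂ hz hgz (hc.iterate (k + 1)).continuousOn
      continuousOn_id ih.le (hlt.le.trans hle)
    exact hno x hx (k + 1) (Nat.succ_pos k) hxe

theorem interior_nonempty_of_ordConnected [DenselyOrdered X] {M : Set X} (hM : M.OrdConnected)
    (hM' : M.Nontrivial) : (interior M).Nonempty := by
  obtain ⟨a, ha, b, hb, hab⟩ := hM'.exists_lt
  obtain ⟨c, hc⟩ := exists_between hab
  exact ⟨c, interior_maximal (Ioo_subset_Icc_self.trans (hM.out ha hb)) isOpen_Ioo hc⟩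

end Order

/-! ### Periodic points and weak mixing of interval maps -/

section Interval

variable {X : Type*} [ConditionallyCompleteLinearOrder X] [TopologicalSpace X] [OrderTopology X]
  [DenselyOrdered X] [Nontrivial X] {f : X → X}

/-- A transitive map of an interval has a fixed point. -/
theorem IsTransitive.exists_fixed (hf : IsTransitive f) (hc : Continuous f) : ∃ c, f c = c := by
  by_contra! hno
  obtain ⟨a, b, hab⟩ := exists_pair_lt X
  obtain ⟨m, ham, hmb⟩ := exists_between hab
  rcases lt_or_gt_of_ne (hno m) with hm | hm
  · have hlt : ∀ x, f x < x := by
      intro x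
      by_contra! hx
      obtain ⟨y, hy⟩ := intermediate_value_univ₂ hc continuous_id hm.le hx
      exact hno y hy
    obtain ⟨k, -, x, hx, hxV⟩ := hf.exists_iterate_mem (isOpen_Iio (a := m))
      (isOpen_Ioi (a := m)) ⟨a, ham⟩ ⟨b, hmb⟩
    have hmaps : MapsTo f (Iio m) (Iio m) := fun y hy => (hlt y).trans hy
    exact lt_asymm hxV (hmaps.iterate k hx)
  · have hlt : ∀ x, x < f x := by
      intro x
      by_contra! hx
      obtain ⟨y, hy⟩ := intermediate_value_univ₂ hc continuous_id hx hm.le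
      exact hno y hy
    obtain ⟨k, -, x, hx, hxV⟩ := hf.exists_iterate_mem (isOpen_Ioi (a := m))
      (isOpen_Iio (a := m)) ⟨b, hmb⟩ ⟨a, ham⟩
    have hmaps : MapsTo f (Ioi m) (Ioi m) := fun y hy => lt_trans hy (hlt y)
    exact lt_asymm hxV (hmaps.iterate k hx)

/-- Periodic points of a transitive interval map are dense. -/
theorem IsTransitive.exists_periodic (hf : IsTransitive f) (hc : Continuous f) {U : Set X}
    (hU : IsOpen U) (hU' : U.Nonempty) : ∃ x ∈ U, ∃ n, 1 ≤ n ∧ f^[n] x = x := by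
  obtain ⟨a, b, hab, hsub⟩ := hU.exists_Ioo_subset hU'
  by_contra! hno
  have hno' : ∀ m, 1 ≤ m → ∀ x ∈ Ioo a b, ∀ n, 1 ≤ n → (f^[m])^[n] x ≠ x := by
    intro m hm x hx n hn
    rw [← Function.iterate_mul]
    exact hno x (hsub hx) _ (Nat.mul_pos hm hn)
  obtain ⟨c, hac, hcb⟩ := exists_between hab
  obtain ⟨m, hm, z, hz, hmz⟩ := hf.exists_iterate_mem (isOpen_Ioo (a := a) (b := c))
    (isOpen_Ioo (a := c) (b := b)) (nonempty_Ioo.2 hac) (nonempty_Ioo.2 hcb)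
  obtain ⟨n, hn, w, hw, hnw⟩ := hf.exists_iterate_mem (isOpen_Ioo (a := c) (b := b))
    (isOpen_Ioo (a := a) (b := c)) (nonempty_Ioo.2 hcb) (nonempty_Ioo.2 hac)
  have hl : Ioo a c ⊆ Ioo a b := Ioo_subset_Ioo_right hcb.le
  have hr : Ioo c b ⊆ Ioo a b := Ioo_subset_Ioo_left hac.le
  -- Both displacements persist up to the common time `m * n`, where their opposite signs force a
  -- fixed point.
  have h1 := lt_iterate_of_no_periodic (hc.iterate m) isPreconnected_Ioo (hno' m hm) (hl hz)
    (hr hmz) (hz.2.trans hmz.1) (n - 1)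
  have h2 := iterate_lt_of_no_periodic (hc.iterate n) isPreconnected_Ioo (hno' n hn) (hr hw)
    (hl hnw) (hnw.2.trans hw.1) (m - 1)
  rw [Nat.sub_add_cancel hn, ← Function.iterate_mul] at h1
  rw [Nat.sub_add_cancel hm, ← Function.iterate_mul, mul_comm] at h2
  obtain ⟨x, hx, hxe⟩ := isPreconnected_Ioo.intermediate_value₂ (hr hw) (hl hz)
    (hc.iterate (m * n)).continuousOn continuousOn_id h2.le h1.le
  exact hno x (hsub hx) _ (Nat.mul_pos hm hn) hxe

theorem nontrivial_of_isOpen {U : Set X} (hU : IsOpen U) (hU' : U.Nonempty) : U.Nontrivial := by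
  obtain ⟨a, b, hab, hsub⟩ := hU.exists_Ioo_subset hU'
  obtain ⟨c, hac, hcb⟩ := exists_between hab
  obtain ⟨d, had, hdc⟩ := exists_between hac
  exact ⟨d, hsub ⟨had, hdc.trans hcb⟩, c, hsub ⟨hac, hcb⟩, hdc.ne⟩

/-- A transitive interval map is injective on its dense set of periodic points, so it does not
collapse open sets. -/
theorem IsTransitive.image_nontrivial (hf : IsTransitive f) (hc : Continuous f) {U : Set X}
    (hU : IsOpen U) (hU' : U.Nonempty) : (f '' U).Nontrivial := by
  obtain ⟨x, hx, m, hm, hxm⟩ := hf.exists_periodic hc hU hU'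
  have hne : (U \ {x}).Nonempty := by
    obtain ⟨y, hy, hyx⟩ := (nontrivial_of_isOpen hU hU').exists_ne x
    exact ⟨y, hy, hyx⟩
  obtain ⟨y, hy, n, hn, hyn⟩ := hf.exists_periodic hc (hU.sdiff isClosed_singleton) hne
  refine ⟨f x, ⟨x, hx, rfl⟩, f y, ⟨y, hy.1, rfl⟩, fun he => hy.2 ?_⟩
  have key : f^[m * n] x = f^[m * n] y := by
    obtain ⟨j, hj⟩ := Nat.exists_eq_add_of_le' (Nat.mul_pos hm hn : 1 ≤ m * n)
    rw [hj, Function.iterate_succ_apply, Function.iterate_succ_apply, he]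
  have h1 : f^[m * n] x = x := by
    rw [Function.iterate_mul]; exact Function.iterate_fixed hxm n
  have h2 : f^[m * n] y = y := by
    rw [mul_comm, Function.iterate_mul]; exact Function.iterate_fixed hyn m
  exact h2.symm.trans (key.symm.trans h1)

/-- A cyclic cover of the space by closed convex sets permuted by a bitransitive map is trivial. -/
theorem IsBitransitive.cyclic_cover_trivial (hf : IsBitransitive f) (hc : Continuous f) {p : ℕ}
    [NeZero p] {L : ZMod p → Set X} (hclosed : ∀ i, IsClosed (L i))
    (hconv : ∀ i, (L i).OrdConnected) (hmaps : ∀ i, MapsTo f (L i) (L (i + 1)))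
    (hcover : ⋃ i, L i = univ) (hint : (interior (L 0)).Nonempty) (i : ZMod p) :
    L i = univ := by
  classical
  have ht : IsTransitive f := IsTransitive.of_iterate one_le_two hf
  obtain ⟨c, hfc⟩ := ht.exists_fixed hc
  have hcL : ∀ i, c ∈ L i := by
    obtain ⟨i, hi⟩ := mem_iUnion.1 (hcover.symm ▸ mem_univ c : c ∈ ⋃ i, L i)
    have hn : ∀ n : ℕ, c ∈ L (i + n) := by
      intro n
      induction n with
      | zero => simpa using hi
      | succ n ih =>
        have := hmaps _ ih
        rw [hfc] at this
        simpa [add_assoc] using this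
    intro j
    have := hn (j - i).val
    rwa [ZMod.natCast_zmod_val, add_sub_cancel] at this
  let M : Finset (ZMod p) → Set X := fun F => ⋂ i ∈ F, L i
  have hMconv : ∀ F, (M F).OrdConnected := fun F =>
    ordConnected_biInter fun i _ => hconv i
  have hMc : ∀ F, c ∈ M F := fun F => mem_iInter₂.2 fun i _ => hcL i
  have hMclosed : ∀ F, IsClosed (M F) := fun F => isClosed_biInter fun i _ => hclosed i
  let s : Finset (ZMod p) → Finset (ZMod p) := fun F => F.image (· + 1)
  have hMs : ∀ F, MapsTo f (M F) (M (s F)) := by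
    intro F x hx
    refine mem_iInter₂.2 fun j hj => ?_
    obtain ⟨i, hi, rfl⟩ := Finset.mem_image.1 hj
    exact hmaps i (mem_iInter₂.1 hx i hi)
  have hgood : ∀ F, (interior (M F)).Nonempty → (interior (M (s F))).Nonempty := fun F hF =>
    interior_nonempty_of_ordConnected (hMconv _)
      ((ht.image_nontrivial hc isOpen_interior hF).mono
        ((image_mono interior_subset).trans (hMs F).image_subset))
  have hs_card : ∀ F, (s F).card = F.card := fun F =>
    Finset.card_image_of_injective _ (add_left_injective 1)
  have hs_inj : Function.Injective s := Finset.image_injective (add_left_injective 1)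
  have h0 : ({0} : Finset (ZMod p)) ∈
      (Finset.univ.filter fun F : Finset (ZMod p) => (interior (M F)).Nonempty) := by
    simpa only [M, Finset.mem_filter, Finset.mem_univ, true_and, Finset.mem_singleton,
      iInter_iInter_eq_left] using hint
  -- For `F` of maximal size, two index sets of that size with overlapping intersections have a
  -- union that is no larger, so they coincide.
  obtain ⟨F, hF, hmax⟩ := Finset.exists_max_image _ Finset.card ⟨_, h0⟩
  have hmax0 := hmax _ h0
  simp only [Finset.mem_filter, Finset.mem_univ, true_and] at hF hmax
  have huniq : ∀ F₁ F₂ : Finset (ZMod p), F₁.card = F.card → F₂.card = F.card →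
      (M F₁ ∩ M F₂).Nontrivial → F₁ = F₂ := by
    intro F₁ F₂ h1 h2 hnt
    have hU : M F₁ ∩ M F₂ = M (F₁ ∪ F₂) := by
      ext x
      simp only [M, mem_inter_iff, mem_iInter, Finset.mem_union, or_imp, forall_and]
    rw [hU] at hnt
    have hle := hmax _ (interior_nonempty_of_ordConnected (hMconv _) hnt)
    have e1 := Finset.eq_of_subset_of_card_le (Finset.subset_union_left (s₁ := F₁) (s₂ := F₂))
      (hle.trans h1.ge)
    have e2 := Finset.eq_of_subset_of_card_le (Finset.subset_union_right (s₁ := F₁) (s₂ := F₂))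
      (hle.trans h2.ge)
    exact e1.trans e2.symm
  -- `F`, `s F` and `s (s F)` index three nondegenerate convex sets through `c`. Two of them
  -- overlap, so two index sets agree; injectivity of `s` reduces every case to the claim. Then `M
  -- F` is invariant under `f²`.
  have hss : s (s F) = F := by
    have hg : ∀ i : Fin 3, (interior (M (s^[i] F))).Nonempty ∧ (s^[i] F).card = F.card := by
      intro i
      fin_cases i
      · exact ⟨hF, rfl⟩
      · exact ⟨hgood _ hF, hs_card _⟩
      · exact ⟨hgood _ (hgood _ hF), (hs_card _).trans (hs_card _)⟩
    obtain ⟨i, j, hij, hnt⟩ := exists_overlap (c := c) (M := fun i : Fin 3 => M (s^[i] F))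
      (fun i => hMconv _)
      (fun i => (nontrivial_of_isOpen isOpen_interior (hg i).1).mono interior_subset)
      (fun i => hMc _)
    have he := huniq _ _ (hg i).2 (hg j).2 hnt
    have h1 : F = s F → s (s F) = F := fun h => by rw [← h, ← h]
    have h2 : s F = s (s F) → s (s F) = F := fun h => h1 (hs_inj h)
    fin_cases i <;> fin_cases j <;> first
      | exact absurd rfl hij
      | exact he
      | exact he.symm
      | exact h1 he
      | exact h1 he.symm
      | exact h2 he
      | exact h2 he.symm
  have hMuniv : M F = univ := by
    refine IsTransitive.eq_univ hf (hMclosed F) hF ?_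
    have := (hMs (s F)).comp (hMs F)
    rwa [hss] at this
  have hFne : F.Nonempty := Finset.card_pos.1 (by simpa using hmax0)
  obtain ⟨j, hj⟩ := hFne
  -- Fullness propagates around the cycle because `f` has dense range and each `L i` is closed.
  have hn : ∀ n : ℕ, L (j + n) = univ := by
    intro n
    induction n with
    | zero =>
      refine eq_univ_of_univ_subset ?_
      rw [← hMuniv]
      simpa using biInter_subset_of_mem (t := L) (show j ∈ (F : Set (ZMod p)) from hj)
    | succ n ih =>
      have hm := hmaps (j + n)
      rw [ih, add_assoc] at hm
      rw [Nat.cast_add_one]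
      by_contra hne
      obtain ⟨-, x, hx⟩ := ht.preimage_iterate_nonempty hc (hclosed _).isOpen_compl
        (nonempty_compl.2 hne) 1
      exact hx (hm (mem_univ x))
  have := hn (i - j).val
  rwa [ZMod.natCast_zmod_val, add_sub_cancel] at this

/-- Every iterate of a bitransitive interval map is transitive. -/
theorem IsBitransitive.exists_dvd_iterate_mem (hf : IsBitransitive f) (hc : Continuous f) {q : ℕ}
    (hq : 1 ≤ q) {U V : Set X} (hU : IsOpen U) (hU' : U.Nonempty) (hV : IsOpen V)
    (hV' : V.Nonempty) : ∃ n, q ∣ n ∧ ∃ x ∈ U, f^[n] x ∈ V := by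
  have ht : IsTransitive f := IsTransitive.of_iterate one_le_two hf
  obtain ⟨a, b, hab, hsub⟩ := hU.exists_Ioo_subset hU'
  obtain ⟨z, hz, m, hm, hzm⟩ := ht.exists_periodic hc isOpen_Ioo (nonempty_Ioo.2 hab)
  -- The modulus is a period of `z`, so that the images in one residue class share an orbit point,
  -- and a multiple of `q`, so that residue `0` gives divisibility by `q`.
  have hp : 1 ≤ m * q := Nat.mul_pos hm hq
  have hzp : Function.IsPeriodicPt f (m * q) z := by
    have : Function.IsPeriodicPt f m z := hzm
    exact this.mul_const q
  have : NeZero (m * q) := ⟨by omega⟩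
  let K : ZMod (m * q) → Set X := fun i => ⋃ n : {n : ℕ // (n : ZMod (m * q)) = i}, f^[n] '' Ioo a b
  have hKconn : ∀ i, IsPreconnected (K i) := by
    intro i
    refine isPreconnected_iUnion ⟨f^[i.val] z, mem_iInter.2 ?_⟩ fun n =>
      isPreconnected_Ioo.image _ (hc.iterate _).continuousOn
    rintro ⟨n, rfl⟩
    refine ⟨z, hz, ?_⟩
    rw [ZMod.val_natCast]
    exact (hzp.iterate_mod_apply n).symm
  have hsubK : Ioo a b ⊆ K 0 := fun x hx =>
    mem_iUnion.2 ⟨⟨0, by simp⟩, x, hx, rfl⟩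
  have hmapsK : ∀ i, MapsTo f (K i) (K (i + 1)) := by
    intro i y hy
    obtain ⟨⟨n, rfl⟩, x, hx, rfl⟩ := mem_iUnion.1 hy
    exact mem_iUnion.2 ⟨⟨n + 1, by simp⟩, x, hx, Function.iterate_succ_apply' f n x⟩
  have hmaps : ∀ i, MapsTo f (closure (K i)) (closure (K (i + 1))) := fun i =>
    (hmapsK i).closure hc
  have hint : (interior (closure (K 0))).Nonempty :=
    (nonempty_Ioo.2 hab).mono (interior_maximal (hsubK.trans subset_closure) isOpen_Ioo)
  have hcover : ⋃ i, closure (K i) = univ := by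
    refine ht.eq_univ (isClosed_iUnion_of_finite fun i => isClosed_closure)
      (hint.mono (interior_mono (subset_iUnion (fun i => closure (K i)) 0))) ?_
    intro x hx
    obtain ⟨i, hi⟩ := mem_iUnion.1 hx
    exact mem_iUnion.2 ⟨i + 1, hmaps i hi⟩
  have huniv := hf.cyclic_cover_trivial hc (fun i => isClosed_closure)
    (fun i => (hKconn i).closure.ordConnected) hmaps hcover hint 0
  obtain ⟨y, hyV, hyK⟩ := (dense_iff_closure_eq.2 huniv).inter_open_nonempty V hV hV'
  obtain ⟨⟨n, hn⟩, x, hx, rfl⟩ := mem_iUnion.1 hyK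
  exact ⟨n, (Nat.dvd_mul_left q m).trans ((ZMod.natCast_eq_zero_iff _ _).1 hn), x, hsub hx, hyV⟩

/-- A bitransitive interval map is weakly mixing. -/
theorem IsBitransitive.weakly_mixing (hf : IsBitransitive f) (hc : Continuous f)
    {U₁ U₂ V₁ V₂ : Set X} (hU₁ : IsOpen U₁) (hU₂ : IsOpen U₂) (hV₁ : IsOpen V₁) (hV₂ : IsOpen V₂)
    (hU₁' : U₁.Nonempty) (hU₂' : U₂.Nonempty) (hV₁' : V₁.Nonempty) (hV₂' : V₂.Nonempty) (N : ℕ) :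
    ∃ n, N ≤ n ∧ (∃ x ∈ U₁, f^[n] x ∈ V₁) ∧ ∃ x ∈ U₂, f^[n] x ∈ V₂ := by
  have ht : IsTransitive f := IsTransitive.of_iterate one_le_two hf
  obtain ⟨hW, hW'⟩ := ht.preimage_iterate_nonempty hc hV₁ hV₁' N
  obtain ⟨n, -, x, hx, hxn⟩ := ht.exists_iterate_mem hU₁ hW hU₁' hW'
  rw [mem_preimage, ← Function.iterate_add_apply] at hxn
  -- `z` travels from `U₁` to `V₁` at every time `N + n + p * k`, which leaves `k` free for the
  -- second pair.
  obtain ⟨z, hz, p, hp, hzp⟩ := ht.exists_periodic hc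
    (hU₁.inter (hV₁.preimage (hc.iterate (N + n)))) ⟨x, hx, hxn⟩
  obtain ⟨hW₂, hW₂'⟩ := ht.preimage_iterate_nonempty hc hV₂ hV₂' (N + n)
  obtain ⟨_, ⟨k, rfl⟩, y, hy, hyk⟩ := hf.exists_dvd_iterate_mem hc hp hU₂ hU₂' hW₂ hW₂'
  rw [mem_preimage, ← Function.iterate_add_apply] at hyk
  refine ⟨N + n + p * k, by omega, ⟨z, hz.1, ?_⟩, y, hy, hyk⟩
  have hzk : f^[p * k] z = z := by
    rw [Function.iterate_mul]; exact Function.iterate_fixed hzp k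
  rw [Function.iterate_add_apply, hzk]
  exact hz.2

end Interval

end IntervalDynamics

/-! ### Mycielski's theorem by Baire category in a function space -/

namespace IntervalDynamics

open TopologicalSpace Topology

/-- The disjoint union of countably many Cantor sets. -/
abbrev CantorSum : Type := ℕ × (ℕ → Fin 2)

/-- The component of a point of `CantorSum` together with its first `d` digits. -/
def truncate (d : ℕ) (y : CantorSum) : ℕ × (Fin d → Fin 2) := (y.1, fun i => y.2 i)

/-- Extension of a finite word by zeros. -/
def extend (d : ℕ) (w : ℕ × (Fin d → Fin 2)) : CantorSum :=
  (w.1, fun i => if h : i < d then w.2 ⟨i, h⟩ else 0)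

theorem continuous_truncate (d : ℕ) : Continuous (truncate d) := by
  unfold truncate
  fun_prop

theorem exists_truncate_ne {p q : CantorSum} (h : p ≠ q) : ∃ d, truncate d p ≠ truncate d q := by
  by_contra! hall
  refine h (Prod.ext (congrArg (fun w => w.1) (hall 0) :) (funext fun i => ?_))
  exact congrFun (congrArg Prod.snd (hall (i + 1))) ⟨i, i.lt_succ_self⟩

theorem truncate_ne_of_le {d e : ℕ} (hde : d ≤ e) {p q : CantorSum}
    (h : truncate d p ≠ truncate d q) : truncate e p ≠ truncate e q := by
  intro he
  refine h (Prod.ext (congrArg (fun w => w.1) he :) (funext fun i => ?_))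
  exact congrFun (congrArg Prod.snd he) ⟨i, i.2.trans_le hde⟩

/-- Letting the point vary together with the depth is what gives locally uniform convergence in
`tendsto_cylinderMap`. -/
theorem tendsto_extend_truncate (y : CantorSum) :
    Tendsto (fun z : ℕ × CantorSum => extend z.1 (truncate z.1 z.2)) (atTop ×ˢ 𝓝 y) (𝓝 y) := by
  have h2 : Tendsto (fun z : ℕ × CantorSum => z.2) (atTop ×ˢ 𝓝 y) (𝓝 y) := tendsto_snd
  have ha := (continuous_fst.tendsto y).comp h2
  have hb := (continuous_snd.tendsto y).comp h2
  refine Tendsto.prodMk_nhds (x := y.1) (y := y.2) ha (tendsto_pi_nhds.2 fun i => ?_)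
  refine (tendsto_pi_nhds.1 hb i).congr' ?_
  filter_upwards [tendsto_fst.eventually (eventually_gt_atTop i)] with z hz
  simp [truncate, hz]

section Generic

variable {X : Type*}

/-- It suffices to perturb the coordinates `i` and `j`, and updating them is continuous. -/
theorem dense_setOf_pair_mem [TopologicalSpace X] {D : Type*} {R : Set (X × X)} (hR : Dense R)
    {i j : D} (hij : i ≠ j) : Dense {v : D → X | (v i, v j) ∈ R} := by
  classical
  rw [dense_iff_inter_open]
  rintro W hW ⟨v, hv⟩
  have hcont : Continuous fun p : X × X => Function.update (Function.update v i p.1) j p.2 :=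
    Continuous.update (Continuous.update (continuous_const (y := v)) i continuous_fst) j
      continuous_snd
  obtain ⟨p, hpW, hpR⟩ := hR.inter_open_nonempty _ (hW.preimage hcont) ⟨(v i, v j), by simpa⟩
  exact ⟨_, hpW, by simpa [hij] using hpR⟩

theorem dense_setOf_forall_pair_mem [TopologicalSpace X] [IsCompletelyMetrizableSpace X]
    {D : Type*} [Countable D] {R : Set (X × X)} (hR : Dense R) (hRo : IsOpen R) :
    Dense {v : D → X | ∀ i j, i ≠ j → (v i, v j) ∈ R} := by
  have key : Dense (⋂ k : {k : D × D // k.1 ≠ k.2}, {v : D → X | (v k.1.1, v k.1.2) ∈ R}) := by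
    refine dense_iInter_of_isOpen (fun k => ?_) fun k => dense_setOf_pair_mem hR k.2
    exact hRo.preimage ((continuous_apply _).prodMk (continuous_apply _))
  refine key.mono fun v hv i j hij => mem_iInter.1 hv ⟨(i, j), hij⟩

/-- A basic open set of the product constrains finitely many coordinates, so one is free to be moved
into `U`. -/
theorem dense_setOf_exists_mem [TopologicalSpace X] {D : Type*} [Infinite D] {U : Set X}
    (hU : U.Nonempty) : Dense {v : D → X | ∃ i, v i ∈ U} := by
  classical
  rw [dense_iff_inter_open]
  rintro W hW ⟨v, hv⟩
  obtain ⟨s, u, hu, hsub⟩ := isOpen_pi_iff.1 hW v hv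
  obtain ⟨i, hi⟩ := Infinite.exists_notMem_finset s
  obtain ⟨x, hx⟩ := hU
  refine ⟨Function.update v i x, hsub fun j hj => ?_, i, by simpa⟩
  have hji : j ≠ i := fun h => hi (h ▸ hj)
  rw [Function.update_of_ne hji]
  exact (hu j hj).2

/-- The map on `CantorSum` that is constant on cylinders of depth `d`. -/
def cylinderMap [TopologicalSpace X] (d : ℕ) (v : ℕ × (Fin d → Fin 2) → X) : C(CantorSum, X) :=
  ⟨v ∘ truncate d, continuous_of_discreteTopology.comp (continuous_truncate d)⟩

theorem continuous_cylinderMap [TopologicalSpace X] (d : ℕ) :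
    Continuous (cylinderMap d : (ℕ × (Fin d → Fin 2) → X) → C(CantorSum, X)) := by
  refine ContinuousMap.continuous_of_continuous_uncurry _ (continuous_iff_continuousAt.2 ?_)
  rintro ⟨v, y⟩
  have h : ContinuousAt (fun z : (ℕ × (Fin d → Fin 2) → X) × CantorSum => z.1 (truncate d y))
      (v, y) := ((continuous_apply _).comp continuous_fst).continuousAt
  refine h.congr ?_
  have hy : ∀ᶠ z : (ℕ × (Fin d → Fin 2) → X) × CantorSum in 𝓝 (v, y),
      truncate d z.2 = truncate d y :=
    (((continuous_truncate d).comp continuous_snd).tendsto (v, y)).eventually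
      ((isOpen_discrete {truncate d y}).mem_nhds (mem_singleton _))
  filter_upwards [hy] with z hz
  simp [Function.uncurry, cylinderMap, hz]

theorem tendsto_cylinderMap [UniformSpace X] (φ : C(CantorSum, X)) :
    Tendsto (fun d => cylinderMap d (φ ∘ extend d)) atTop (𝓝 φ) := by
  refine ContinuousMap.tendsto_of_tendstoLocallyUniformly
    (tendstoLocallyUniformly_iff_forall_tendsto.2 fun y => ?_)
  refine Tendsto.mono_right ?_ (nhds_le_uniformity (φ y))
  exact ((φ.continuous.tendsto y).comp tendsto_snd).prodMk_nhds
    ((φ.continuous.tendsto y).comp (tendsto_extend_truncate y))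

/-- Cylinder maps of large depth approximate every map, which reduces density in the function space
to density in a countable product of copies of `X`. -/
theorem dense_of_dense_preimage_cylinderMap [UniformSpace X] {G : Set C(CantorSum, X)} (d₀ : ℕ)
    (hG : ∀ d, d₀ ≤ d → Dense (cylinderMap d ⁻¹' G)) : Dense G := by
  rw [dense_iff_inter_open]
  rintro W hW ⟨φ, hφ⟩
  obtain ⟨d, hd, hd₀⟩ := (((tendsto_cylinderMap φ).eventually (hW.mem_nhds hφ)).and
    (eventually_ge_atTop d₀)).exists
  obtain ⟨v, hvW, hvG⟩ := (hG d hd₀).inter_open_nonempty _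
    (hW.preimage (continuous_cylinderMap d)) ⟨_, hd⟩
  exact ⟨_, hvW, hvG⟩

/-- Mycielski's theorem: given countably many dense open relations on a Polish space, there is a
continuous map from `CantorSum` with dense range, any two values of which at distinct points are
related. -/
theorem exists_generic_map [TopologicalSpace X] [PolishSpace X] [Nonempty X]
    {ι : Type*} [Countable ι] {R : ι → Set (X × X)} (hRo : ∀ k, IsOpen (R k))
    (hR : ∀ k, Dense (R k)) :
    ∃ φ : C(CantorSum, X), (∀ p q, p ≠ q → ∀ k, (φ p, φ q) ∈ R k) ∧ DenseRange φ := by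
  let _ := upgradeIsCompletelyMetrizable X
  -- Bounding the components and separating points at a fixed depth, rather than by `p ≠ q`, leaves
  -- a compact set of pairs; this makes `G k` open in the compact-open topology.
  let G : ι × ℕ × ℕ → Set C(CantorSum, X) := fun k => {φ | ∀ p q : CantorSum,
    p.1 ≤ k.2.1 → q.1 ≤ k.2.1 → truncate k.2.2 p ≠ truncate k.2.2 q → (φ p, φ q) ∈ R k.1}
  have hGo : ∀ k, IsOpen (G k) := by
    rintro ⟨k, N, d⟩
    have hK : IsCompact ({z : CantorSum × CantorSum | z.1.1 ≤ N ∧ z.2.1 ≤ N ∧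
        truncate d z.1 ≠ truncate d z.2}) := by
      have hI : IsCompact ((Iic N ×ˢ univ : Set CantorSum) ×ˢ (Iic N ×ˢ univ : Set CantorSum)) :=
        ((finite_Iic N).isCompact.prod isCompact_univ).prod
          ((finite_Iic N).isCompact.prod isCompact_univ)
      have hcl : IsClosed {z : CantorSum × CantorSum | truncate d z.1 ≠ truncate d z.2} :=
        (isClosed_discrete {w : (ℕ × (Fin d → Fin 2)) × (ℕ × (Fin d → Fin 2)) | w.1 ≠ w.2}).preimage
          (((continuous_truncate d).comp continuous_fst).prodMk
            ((continuous_truncate d).comp continuous_snd))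
      convert hI.inter_right hcl using 1
      ext z
      simp [and_assoc]
    have hcont : Continuous fun φ : C(CantorSum, X) => φ.prodMap φ := by
      refine ContinuousMap.continuous_of_continuous_uncurry _ ?_
      simp only [Function.uncurry_def, ContinuousMap.prodMap_apply, Prod.map]
      fun_prop
    convert (ContinuousMap.isOpen_setOfPred_mapsTo hK (hRo k)).preimage hcont using 1
    ext φ
    simp only [G, MapsTo, mem_preimage, mem_ofPred_eq, Prod.forall, ContinuousMap.prodMap_apply,
      Prod.map_apply]
    exact ⟨fun h a b c e ⟨h1, h2, h3⟩ => h a b c e h1 h2 h3,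
      fun h a b c e h1 h2 h3 => h a b c e ⟨h1, h2, h3⟩⟩
  have hGd : ∀ k, Dense (G k) := by
    rintro ⟨k, N, d⟩
    refine dense_of_dense_preimage_cylinderMap d fun e hde => ?_
    refine (dense_setOf_forall_pair_mem (hR k) (hRo k)).mono ?_
    intro v hv p q _ _ hpq
    exact hv _ _ (truncate_ne_of_le hde hpq)
  let H : {U : Set X // U ∈ countableBasis X} → Set C(CantorSum, X) := fun U =>
    {φ | ∃ p, φ p ∈ U.1}
  have hHo : ∀ U, IsOpen (H U) := by
    intro U
    have : H U = ⋃ p, (fun φ : C(CantorSum, X) => φ p) ⁻¹' U.1 := by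
      ext φ
      simp [H]
    rw [this]
    exact isOpen_iUnion fun p =>
      (isOpen_of_mem_countableBasis U.2).preimage (ContinuousEvalConst.continuous_eval_const p)
  have hHd : ∀ U, Dense (H U) := by
    intro U
    refine dense_of_dense_preimage_cylinderMap 0 fun e _ => ?_
    refine (dense_setOf_exists_mem (nonempty_of_mem_countableBasis U.2)).mono ?_
    rintro v ⟨w, hw⟩
    refine ⟨extend e w, ?_⟩
    have : truncate e (extend e w) = w := by
      ext <;> simp [truncate, extend]
    simpa [cylinderMap, this] using hw
  have hcount : Countable {U : Set X // U ∈ countableBasis X} :=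
    (countable_countableBasis X).to_subtype
  have hall : Dense (⋂ k, Sum.elim G H k) := by
    refine dense_iInter_of_isOpen ?_ ?_
    · rintro (k | U)
      · exact hGo k
      · exact hHo U
    · rintro (k | U)
      · exact hGd k
      · exact hHd U
  have : Nonempty C(CantorSum, X) := ⟨ContinuousMap.const _ (Classical.arbitrary X)⟩
  obtain ⟨φ, hφ⟩ := hall.nonempty
  rw [mem_iInter] at hφ
  refine ⟨φ, fun p q hpq k => ?_, ?_⟩
  · obtain ⟨d, hd⟩ := exists_truncate_ne hpq
    exact hφ (Sum.inl (k, max p.1 q.1, d)) p q (le_max_left _ _) (le_max_right _ _) hd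
  · refine (isBasis_countableBasis X).dense_iff.2 fun U hU _ => ?_
    obtain ⟨p, hp⟩ := hφ (Sum.inr ⟨U, hU⟩)
    exact ⟨φ p, hp, p, rfl⟩

end Generic

/-! ### Diffuse measures of full support -/

section Measure

/-- Nondiscreteness of the Cantor group is what makes its Haar measure diffuse. -/
instance : (𝓝[≠] (0 : ℕ → Fin 2)).NeBot := by
  have h : Tendsto (fun n : ℕ => (Pi.single n 1 : ℕ → Fin 2)) atTop (𝓝[≠] 0) := by
    refine tendsto_nhdsWithin_iff.2 ⟨tendsto_pi_nhds.2 fun i => ?_,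
      Eventually.of_forall fun n => ?_⟩
    · refine tendsto_const_nhds.congr' ?_
      filter_upwards [eventually_gt_atTop i] with n hn
      simp [hn.ne]
    · simp
  exact h.neBot

/-- `CantorSum` carries a diffuse probability measure of full support. -/
theorem exists_diffuse_measure_cantorSum : ∃ ρ : Measure CantorSum, IsProbabilityMeasure ρ ∧
    NullSingletonClass ρ ∧ ρ.IsOpenPosMeasure := by
  have hcount : (Measure.count : Measure ℕ).IsOpenPosMeasure :=
    ⟨fun U _ hU => by simpa [Measure.count_eq_zero_iff] using hU.ne_empty⟩
  have hdiff : NullSingletonClass (Measure.addHaar : Measure (ℕ → Fin 2)) :=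
    Measure.IsAddHaarMeasure.nullSingletonClass _
  -- This product is only σ-finite; `toFinite` replaces it by a probability measure with the same
  -- null sets.
  let ρ := (Measure.count : Measure ℕ).prod (Measure.addHaar : Measure (ℕ → Fin 2))
  have hρ : NeZero ρ := ⟨fun h => by
    have := isOpen_univ.measure_ne_zero ρ univ_nonempty
    simp [h] at this⟩
  refine ⟨ρ.toFinite, inferInstance, ⟨fun x => ?_⟩, ?_⟩
  · exact toFinite_absolutelyContinuous ρ (measure_singleton x)
  · exact (absolutelyContinuous_toFinite ρ).isOpenPosMeasure

/-- Given countably many dense open relations with irreflexive intersection, a Polish space carries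
a diffuse probability measure of full support that is concentrated on a set of pairwise related
points. -/
theorem exists_measure_concentrated {X : Type*} [TopologicalSpace X] [PolishSpace X] [Nonempty X]
    [MeasurableSpace X] [BorelSpace X] {ι : Type*} [Countable ι] {R : ι → Set (X × X)}
    (hRo : ∀ k, IsOpen (R k)) (hR : ∀ k, Dense (R k)) (hirr : ∀ x, ∃ k, (x, x) ∉ R k) :
    ∃ (μ : Measure X) (S : Set X), IsProbabilityMeasure μ ∧ NullSingletonClass μ ∧
      μ.IsOpenPosMeasure ∧ S.Nontrivial ∧ μ Sᶜ = 0 ∧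
      ∀ x ∈ S, ∀ y ∈ S, x ≠ y → ∀ k, (x, y) ∈ R k := by
  obtain ⟨φ, hφ, hdense⟩ := exists_generic_map hRo hR
  obtain ⟨ρ, hρ, hdiff, hpos⟩ := exists_diffuse_measure_cantorSum
  have hinj : Function.Injective φ := by
    intro p q hpq
    by_contra hne
    obtain ⟨k, hk⟩ := hirr (φ p)
    have := hφ p q hne k
    rw [← hpq] at this
    exact hk this
  have hmeas : Measurable φ := φ.continuous.measurable
  have hrange : MeasurableSet (range φ) :=
    (φ.continuous.measurableEmbedding hinj).measurableSet_range
  refine ⟨ρ.map φ, range φ, Measure.isProbabilityMeasure_map hmeas.aemeasurable, ⟨fun x => ?_⟩,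
    ⟨fun U hU hU' => ?_⟩, ⟨_, ⟨(0, 0), rfl⟩, _, ⟨(1, 0), rfl⟩, fun h => by simpa using hinj h⟩,
    ?_, ?_⟩
  · rw [Measure.map_apply hmeas (measurableSet_singleton x)]
    exact (subsingleton_singleton.preimage hinj).measure_zero ρ
  · rw [Measure.map_apply hmeas hU.measurableSet]
    obtain ⟨p, hp⟩ := hdense.exists_mem_open hU hU'
    exact (hU.preimage φ.continuous).measure_ne_zero ρ ⟨p, hp⟩
  · rw [Measure.map_apply hmeas hrange.compl]
    simp
  · rintro _ ⟨p, rfl⟩ _ ⟨q, rfl⟩ hne k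
    exact hφ p q (fun h => hne (congrArg φ h)) k

end Measure

end IntervalDynamics

/-! ### Straightening a measure by a homeomorphism of the interval -/

namespace IntervalDynamics

open TopologicalSpace Topology ProbabilityTheory

/-- A locally closed set is closed in its coborder, which is open. -/
theorem polishSpace_of_isLocallyClosed {α : Type*} [TopologicalSpace α] [PolishSpace α]
    {s : Set α} (hs : IsLocallyClosed s) : PolishSpace s := by
  have : PolishSpace (coborder s) := (isLocallyClosed_iff_isOpen_coborder.1 hs).polishSpace
  refine IsClosedEmbedding.polishSpace (f := inclusion subset_coborder)
    ⟨IsEmbedding.inclusion _, ?_⟩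
  rw [range_inclusion]
  exact isClosed_preimage_val_coborder

theorem isLocallyClosed_of_ordConnected {s : Set ℝ} (hs : s.OrdConnected) :
    IsLocallyClosed s := by
  have h := hs.isPreconnected.mem_intervals
  simp only [mem_insert_iff, mem_singleton_iff] at h
  rcases h with h | h | h | h | h | h | h | h | h | h <;> rw [h]
  · exact isClosed_Icc.isLocallyClosed
  · exact isClosed_Ici.isLocallyClosed.inter isOpen_Iio.isLocallyClosed
  · exact isOpen_Ioi.isLocallyClosed.inter isClosed_Iic.isLocallyClosed
  · exact isOpen_Ioo.isLocallyClosed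
  · exact isClosed_Ici.isLocallyClosed
  · exact isOpen_Ioi.isLocallyClosed
  · exact isClosed_Iic.isLocallyClosed
  · exact isOpen_Iio.isLocallyClosed
  · exact isOpen_univ.isLocallyClosed
  · exact isOpen_empty.isLocallyClosed

/-- A nondecreasing function does not increase the measure of sets, from its Stieltjes measure to
Lebesgue measure. -/
theorem volume_image_le_stieltjes (F : StieltjesFunction ℝ) (s : Set ℝ) :
    volume (F '' s) ≤ F.measure s := by
  have h : (OuterMeasure.comap F volume.toOuterMeasure) ≤ F.outer := by
    refine OuterMeasure.le_ofFunction.2 fun t => ?_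
    rw [StieltjesFunction.length_eq]
    refine le_iInf fun a => le_iInf fun b => le_iInf fun hab => ?_
    have hsub : F '' t ⊆ Icc (F a) (F b) := by
      rintro _ ⟨x, hx, rfl⟩
      have := hab ⟨hx, by simp [botSet]⟩
      exact ⟨F.mono this.1.le, F.mono this.2⟩
    calc volume (F '' t) ≤ volume (Icc (F a) (F b)) := measure_mono hsub
      _ = ENNReal.ofReal (F b - F a) := Real.volume_Icc
  have := h s
  rw [StieltjesFunction.measure]
  exact this

/-- The jumps of the distribution function are the masses of the atoms. -/
theorem continuous_cdf (ν : Measure ℝ) [IsProbabilityMeasure ν] [NullSingletonClass ν] :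
    Continuous (cdf ν) := by
  refine continuous_iff_continuousAt.2 fun x => ?_
  rw [(cdf ν).mono.continuousAt_iff_leftLim_eq_rightLim, StieltjesFunction.rightLim_eq]
  have h := (cdf ν).measure_singleton x
  rw [measure_cdf, measure_singleton, eq_comm, ENNReal.ofReal_eq_zero] at h
  exact le_antisymm ((cdf ν).mono.leftLim_le le_rfl) (by linarith)

/-- The range of a strictly increasing function lies in the range of any continuous monotone
function with the same bounds. -/
theorem range_subset_range_of_isLUB {X : Type*} [LinearOrder X] [TopologicalSpace X]
    [PreconnectedSpace X] {F G : X → ℝ} {a b : ℝ} (hF : StrictMono F) (hG : Monotone G)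
    (hGc : Continuous G) (hFa : IsGLB (range F) a) (hFb : IsLUB (range F) b)
    (hGa : IsGLB (range G) a) (hGb : IsLUB (range G) b) : range F ⊆ range G := by
  rintro _ ⟨x, rfl⟩
  by_cases hmax : ∃ y, x < y
  · by_cases hmin : ∃ y, y < x
    · obtain ⟨y, hy⟩ := hmax
      obtain ⟨z, hz⟩ := hmin
      have h1 : F x < b := (hF hy).trans_le (hFb.1 ⟨y, rfl⟩)
      have h2 : a < F x := (hFa.1 ⟨z, rfl⟩).trans_lt (hF hz)
      obtain ⟨_, ⟨u, rfl⟩, hu⟩ := (lt_isLUB_iff hGb).1 h1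
      obtain ⟨_, ⟨v, rfl⟩, hv⟩ := (isGLB_lt_iff hGa).1 h2
      exact mem_range_of_exists_le_of_exists_ge hGc ⟨v, hv.le⟩ ⟨u, hu.le⟩
    · push Not at hmin
      have h1 : IsLeast (range G) (G x) := ⟨⟨x, rfl⟩, forall_mem_range.2 fun y => hG (hmin y)⟩
      have h2 : IsLeast (range F) (F x) :=
        ⟨⟨x, rfl⟩, forall_mem_range.2 fun y => hF.monotone (hmin y)⟩
      exact ⟨x, (h1.isGLB.unique hGa).trans (hFa.unique h2.isGLB)⟩
  · push Not at hmax
    have h1 : IsGreatest (range G) (G x) := ⟨⟨x, rfl⟩, forall_mem_range.2 fun y => hG (hmax y)⟩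
    have h2 : IsGreatest (range F) (F x) :=
      ⟨⟨x, rfl⟩, forall_mem_range.2 fun y => hF.monotone (hmax y)⟩
    exact ⟨x, (h1.isLUB.unique hGb).trans (hFb.unique h2.isLUB)⟩

/-- Two bounded continuous strictly increasing functions on an interval differ by an order
automorphism, up to an affine normalization of their ranges. -/
theorem exists_orderIso_affine {X : Type*} [LinearOrder X] [TopologicalSpace X]
    [PreconnectedSpace X] [Nontrivial X] {F G : X → ℝ} (hF : StrictMono F) (hG : StrictMono G)
    (hFc : Continuous F) (hGc : Continuous G) (hFa : BddBelow (range F)) (hFb : BddAbove (range F))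
    (hGa : BddBelow (range G)) (hGb : BddAbove (range G)) :
    ∃ (h : X ≃o X) (r t : ℝ), ∀ x, G (h x) = r * F x + t := by
  have hlt : ∀ {E : X → ℝ}, StrictMono E → BddBelow (range E) → BddAbove (range E) →
      sInf (range E) < sSup (range E) := by
    intro E hE ha hb
    obtain ⟨x, y, hxy⟩ := exists_pair_lt X
    exact (csInf_le ha ⟨x, rfl⟩).trans_lt ((hE hxy).trans_le (le_csSup hb ⟨y, rfl⟩))
  have hFlt := hlt hF hFa hFb
  have hGlt := hlt hG hGa hGb
  have hFa' := isGLB_csInf (range_nonempty F) hFa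
  have hFb' := isLUB_csSup (range_nonempty F) hFb
  have hGa' := isGLB_csInf (range_nonempty G) hGa
  have hGb' := isLUB_csSup (range_nonempty G) hGb
  generalize sInf (range F) = a at *
  generalize sSup (range F) = b at *
  generalize sInf (range G) = c at *
  generalize sSup (range G) = d at *
  obtain ⟨r, t, hr, hra, hrb⟩ : ∃ r t : ℝ, 0 < r ∧ r * a + t = c ∧ r * b + t = d := by
    refine ⟨(d - c) / (b - a), c - (d - c) / (b - a) * a, by
      have := sub_pos.2 hFlt; have := sub_pos.2 hGlt; positivity, by ring, ?_⟩
    have : b - a ≠ 0 := (sub_pos.2 hFlt).ne'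
    field_simp
    ring
  let e : ℝ ≃o ℝ := (OrderIso.mulLeft₀ r hr).trans (OrderIso.addRight t)
  have he : ∀ x, e x = r * x + t := fun x => rfl
  let H : X → ℝ := fun x => r * F x + t
  have hHmono : StrictMono H := fun x y hxy => by
    have := mul_lt_mul_of_pos_left (hF hxy) hr
    simp only [H]
    linarith
  have hHc : Continuous H := by fun_prop
  have hHr : range H = e '' range F := by
    rw [← range_comp]; rfl
  have hHa : IsGLB (range H) c := by
    rw [hHr, ← hra, ← he, e.isGLB_image']
    exact hFa'
  have hHb : IsLUB (range H) d := by
    rw [hHr, ← hrb, ← he, e.isLUB_image']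
    exact hFb'
  have h1 := range_subset_range_of_isLUB hHmono hG.monotone hGc hHa hHb hGa' hGb'
  have h2 := range_subset_range_of_isLUB hG hHmono.monotone hHc hGa' hGb' hHa hHb
  choose k hk using fun x => h1 ⟨x, rfl⟩
  have hkm : StrictMono k := fun x y hxy => by
    rw [← hG.lt_iff_lt, hk, hk]
    exact hHmono hxy
  have hks : Function.Surjective k := fun y => by
    obtain ⟨x, hx⟩ := h2 ⟨y, rfl⟩
    exact ⟨x, hG.injective ((hk x).trans hx)⟩
  exact ⟨hkm.orderIsoOfSurjective k hks, r, t, hk⟩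

/-- A diffuse probability measure of full support on an interval is equivalent to Lebesgue measure
up to a homeomorphism of the interval. -/
theorem exists_homeomorph_null_image {I : Set ℝ} (hI : I.OrdConnected) (hne : I.Nontrivial)
    (μ : Measure I) [IsProbabilityMeasure μ] [NullSingletonClass μ] [μ.IsOpenPosMeasure] :
    ∃ h : I ≃ₜ I, ∀ s : Set I, μ s = 0 → volume ((fun x => (h x : ℝ)) '' s) = 0 := by
  have : Nontrivial I := hne.coe_sort
  have : PreconnectedSpace I := Subtype.preconnectedSpace hI.isPreconnected
  have hval : Measurable (Subtype.val : I → ℝ) := measurable_subtype_coe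
  have hemb : MeasurableEmbedding (Subtype.val : I → ℝ) := .subtype_coe hI.measurableSet
  let ν : Measure ℝ := μ.map Subtype.val
  have : IsProbabilityMeasure ν := Measure.isProbabilityMeasure_map hval.aemeasurable
  have : NullSingletonClass ν := ⟨fun x => by
    rw [Measure.map_apply hval (measurableSet_singleton x)]
    exact (subsingleton_singleton.preimage Subtype.val_injective).measure_zero μ⟩
  let F : I → ℝ := fun x => cdf ν x
  have hF : StrictMono F := by
    intro x y hxy
    have h := (cdf ν).measure_Ioc x y
    rw [measure_cdf, Measure.map_apply hval measurableSet_Ioc] at h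
    have hpos : 0 < μ (Subtype.val ⁻¹' Ioc (x : ℝ) y) := by
      obtain ⟨z, hxz, hzy⟩ := exists_between hxy
      refine lt_of_lt_of_le (isOpen_Ioo.measure_pos μ ⟨z, hxz, hzy⟩) (measure_mono ?_)
      exact fun w hw => ⟨hw.1, hw.2.le⟩
    rw [h, ENNReal.ofReal_pos] at hpos
    exact sub_pos.1 hpos
  -- The arctangent bounds the coordinate when `I` is unbounded; the resulting homeomorphism is `tan
  -- (r * F x + t)`.
  let G : I → ℝ := fun x => Real.arctan x
  have hG : StrictMono G := fun x y hxy => Real.arctan_strictMono hxy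
  obtain ⟨h, r, t, hh⟩ := exists_orderIso_affine hF hG
    ((continuous_cdf ν).comp continuous_subtype_val)
    (Real.continuous_arctan.comp continuous_subtype_val)
    ⟨0, by rintro _ ⟨x, rfl⟩; exact cdf_nonneg ν _⟩ ⟨1, by rintro _ ⟨x, rfl⟩; exact cdf_le_one ν _⟩
    ⟨-(Real.pi / 2), by rintro _ ⟨x, rfl⟩; exact (Real.neg_pi_div_two_lt_arctan _).le⟩
    ⟨Real.pi / 2, by rintro _ ⟨x, rfl⟩; exact (Real.arctan_lt_pi_div_two _).le⟩
  refine ⟨h.toHomeomorph, fun s hs => ?_⟩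
  have h0 : volume (cdf ν '' (Subtype.val '' s)) = 0 := by
    refine le_antisymm ((volume_image_le_stieltjes _ _).trans ?_) zero_le
    rw [measure_cdf, hemb.map_apply, preimage_image_eq _ Subtype.val_injective, hs]
  -- `F` sends `μ`-null sets to Lebesgue null sets, and the differentiable map `tan (r * y + t)`
  -- keeps them null.
  have h1 := addHaar_image_eq_zero_of_differentiableOn_of_addHaar_eq_zero volume
    (f := fun y => Real.tan (r * y + t)) (s := cdf ν '' (Subtype.val '' s)) ?_ h0
  · refine measure_mono_null ?_ h1
    rintro _ ⟨x, hx, rfl⟩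
    refine ⟨_, ⟨x, ⟨x, hx, rfl⟩, rfl⟩, ?_⟩
    change Real.tan (r * F x + t) = h x
    rw [← hh x, Real.tan_arctan]
  · rintro _ ⟨_, ⟨x, hx, rfl⟩, rfl⟩
    have hcos : Real.cos (r * F x + t) ≠ 0 := by
      rw [← hh x]
      exact (Real.cos_arctan_pos _).ne'
    have hd : DifferentiableAt ℝ (fun y : ℝ => r * y + t) (F x) := by fun_prop
    exact (DifferentiableAt.comp (F x) (Real.differentiableAt_tan.2 hcos) hd).differentiableWithinAt

end IntervalDynamics

/-! ### From dense pair orbits to extreme scrambling -/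

namespace IntervalDynamics

open TopologicalSpace Topology

/-- The pairs of distinct points of `S` visit every product of nonempty open sets infinitely
often. -/
def HasDensePairs {X : Type*} [TopologicalSpace X] (f : X → X) (S : Set X) : Prop :=
  ∀ x ∈ S, ∀ y ∈ S, x ≠ y → ∀ U V : Set X, IsOpen U → IsOpen V → U.Nonempty → V.Nonempty →
    ∀ N : ℕ, ∃ n, N ≤ n ∧ f^[n] x ∈ U ∧ f^[n] y ∈ V

theorem HasDensePairs.image {X Y : Type*} [TopologicalSpace X] [TopologicalSpace Y] {f : X → X}
    {g : Y → Y} {S : Set X} (hS : HasDensePairs f S) (h : X ≃ₜ Y) (hfg : Function.Semiconj h f g) :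
    HasDensePairs g (h '' S) := by
  rintro _ ⟨x, hx, rfl⟩ _ ⟨y, hy, rfl⟩ hne U V hU hV hU' hV' N
  obtain ⟨n, hn, h1, h2⟩ := hS x hx y hy (fun he => hne (congrArg h he)) (h ⁻¹' U) (h ⁻¹' V)
    (hU.preimage h.continuous) (hV.preimage h.continuous) (hU'.preimage h.surjective)
    (hV'.preimage h.surjective) N
  refine ⟨n, hn, ?_, ?_⟩
  · rw [← (hfg.iterate_right n).eq]; exact h1
  · rw [← (hfg.iterate_right n).eq]; exact h2

/-- Each condition is one choice of target sets: the same small ball twice for the lower limit, rays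
separated by a gap `p < q` for the upper limit, and rays beyond `u` and `v` for the covering of `Icc
u v`. -/
theorem HasDensePairs.isExtremelyScrambled {I : Set ℝ} (hI : I.OrdConnected) {f : I → I}
    {S : Set I} (hS : HasDensePairs f S) (hS' : S.Nontrivial) : IsExtremelyScrambled f S := by
  obtain ⟨a, b, hab⟩ : ∃ a b : I, a < b := by
    obtain ⟨a, -, b, -, hab⟩ := hS'.exists_lt
    exact ⟨a, b, hab⟩
  obtain ⟨p, hap, hpb⟩ := exists_between hab
  obtain ⟨q, hpq, hqb⟩ := exists_between hpb
  refine ⟨⟨edist p q, edist_pos.2 hpq.ne, hS', fun x hx y hy hxy => ⟨?_, ?_⟩⟩, ?_⟩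
  · refine le_antisymm (le_of_forall_pos_le_add fun ε hε => ?_) zero_le
    rw [zero_add]
    have hε2 : 0 < ε / 2 := ENNReal.half_pos hε.ne'
    refine liminf_le_of_frequently_le' (frequently_atTop.2 fun N => ?_)
    obtain ⟨n, hn, h1, h2⟩ := hS x hx y hy hxy (Metric.eball a (ε / 2)) (Metric.eball a (ε / 2))
      Metric.isOpen_eball Metric.isOpen_eball ⟨a, Metric.mem_eball_self hε2⟩
      ⟨a, Metric.mem_eball_self hε2⟩ N
    refine ⟨n, hn, (edist_triangle_right _ _ a).trans ?_⟩
    rw [← ENNReal.add_halves ε]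
    exact add_le_add (le_of_lt h1) (le_of_lt h2)
  · refine le_limsup_of_frequently_le' (frequently_atTop.2 fun N => ?_)
    obtain ⟨n, hn, h1, h2⟩ := hS x hx y hy hxy (Iio p) (Ioi q) isOpen_Iio isOpen_Ioi
      ⟨a, hap⟩ ⟨b, hqb⟩ N
    refine ⟨n, hn, ?_⟩
    have h1' : (f^[n] x : ℝ) < p := h1
    have h2' : (q : ℝ) < f^[n] y := h2
    have hpq' : (p : ℝ) < q := hpq
    rw [edist_dist, edist_dist, Subtype.dist_eq, Subtype.dist_eq, Real.dist_eq, Real.dist_eq,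
      abs_of_neg (by linarith), abs_of_neg (by linarith)]
    exact ENNReal.ofReal_le_ofReal (by linarith)
  · intro c hc d hd hcd u v huv hsub
    have hu : u ∈ interior I := hsub (left_mem_Icc.2 huv.le)
    have hv : v ∈ interior I := hsub (right_mem_Icc.2 huv.le)
    obtain ⟨l, hlu, hl⟩ : ∃ l < u, l ∈ I := by
      obtain ⟨l, hl, hlu⟩ := ((eventually_mem_nhdsWithin (a := u) (s := Iio u)).and
        (mem_nhdsWithin_of_mem_nhds (mem_interior_iff_mem_nhds.1 hu))).exists
      exact ⟨l, hl, hlu⟩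
    obtain ⟨m, hvm, hm⟩ : ∃ m > v, m ∈ I := by
      obtain ⟨m, hm, hvm⟩ := ((eventually_mem_nhdsWithin (a := v) (s := Ioi v)).and
        (mem_nhdsWithin_of_mem_nhds (mem_interior_iff_mem_nhds.1 hv))).exists
      exact ⟨m, hm, hvm⟩
    obtain ⟨n, hn, h1, h2⟩ := hS c hc d hd hcd (Subtype.val ⁻¹' Iio u) (Subtype.val ⁻¹' Ioi v)
      (isOpen_Iio.preimage continuous_subtype_val) (isOpen_Ioi.preimage continuous_subtype_val)
      ⟨⟨l, hl⟩, hlu⟩ ⟨⟨m, hm⟩, hvm⟩ 1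
    refine ⟨n, hn, Icc_subset_uIcc.trans' (Icc_subset_Icc (le_of_lt h1) (le_of_lt h2))⟩

/-- A bitransitive map of a Polish interval has a diffuse probability measure of full support
concentrated on a set whose pairs of distinct points have dense orbits. -/
theorem IsBitransitive.exists_measure_hasDensePairs {X : Type*}
    [ConditionallyCompleteLinearOrder X] [TopologicalSpace X] [OrderTopology X] [DenselyOrdered X]
    [Nontrivial X] [PolishSpace X] [MeasurableSpace X] [BorelSpace X] {f : X → X}
    (hf : IsBitransitive f) (hc : Continuous f) :
    ∃ (μ : Measure X) (S : Set X), IsProbabilityMeasure μ ∧ NullSingletonClass μ ∧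
      μ.IsOpenPosMeasure ∧ S.Nontrivial ∧ μ Sᶜ = 0 ∧ HasDensePairs f S := by
  let B := {U : Set X // U ∈ countableBasis X}
  have hB : Countable B := (countable_countableBasis X).to_subtype
  let R : B × B × ℕ → Set (X × X) := fun k =>
    ⋃ n ∈ Ici k.2.2, (f^[n] ⁻¹' k.1.1) ×ˢ (f^[n] ⁻¹' k.2.1.1)
  have hmem : ∀ k x y, (x, y) ∈ R k ↔ ∃ n, k.2.2 ≤ n ∧ f^[n] x ∈ k.1.1 ∧ f^[n] y ∈ k.2.1.1 := by
    intro k x y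
    simp only [R, mem_iUnion₂, mem_Ici, mem_prod, mem_preimage, exists_prop]
  have hBo : ∀ U : B, IsOpen U.1 := fun U => isOpen_of_mem_countableBasis U.2
  have hBne : ∀ U : B, U.1.Nonempty := fun U => nonempty_of_mem_countableBasis U.2
  have hRo : ∀ k, IsOpen (R k) := fun k => isOpen_biUnion fun n _ =>
    ((hBo _).preimage (hc.iterate n)).prod ((hBo _).preimage (hc.iterate n))
  have hR : ∀ k, Dense (R k) := by
    intro k
    rw [dense_iff_inter_open]
    rintro W hW ⟨⟨x, y⟩, hxy⟩
    obtain ⟨U, V, hU, hV, hx, hy, hsub⟩ := isOpen_prod_iff.1 hW x y hxy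
    obtain ⟨n, hn, ⟨x', hx', hx''⟩, y', hy', hy''⟩ := hf.weakly_mixing hc hU hV (hBo k.1)
      (hBo k.2.1) ⟨x, hx⟩ ⟨y, hy⟩ (hBne _) (hBne _) k.2.2
    exact ⟨(x', y'), hsub ⟨hx', hy'⟩, (hmem _ _ _).2 ⟨n, hn, hx'', hy''⟩⟩
  have hsub : ∀ U : Set X, IsOpen U → U.Nonempty → ∃ V : B, V.1 ⊆ U := by
    rintro U hU ⟨x, hx⟩
    obtain ⟨V, hV, -, hVU⟩ := (isBasis_countableBasis X).exists_subset_of_mem_open hx hU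
    exact ⟨⟨V, hV⟩, hVU⟩
  -- A single orbit cannot be in two disjoint rays at the same time.
  have hirr : ∀ x, ∃ k, (x, x) ∉ R k := by
    intro x
    obtain ⟨a, b, hab⟩ := exists_pair_lt X
    obtain ⟨m, ham, hmb⟩ := exists_between hab
    obtain ⟨U, hU⟩ := hsub (Iio m) isOpen_Iio ⟨a, ham⟩
    obtain ⟨V, hV⟩ := hsub (Ioi m) isOpen_Ioi ⟨b, hmb⟩
    refine ⟨(U, V, 0), fun h => ?_⟩
    obtain ⟨n, -, h1, h2⟩ := (hmem _ _ _).1 h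
    exact lt_asymm (hU h1) (hV h2)
  obtain ⟨μ, S, h1, h2, h3, h4, h5, h6⟩ := exists_measure_concentrated hRo hR hirr
  refine ⟨μ, S, h1, h2, h3, h4, h5, fun x hx y hy hxy U V hU hV hU' hV' N => ?_⟩
  obtain ⟨U', hU''⟩ := hsub U hU hU'
  obtain ⟨V', hV''⟩ := hsub V hV hV'
  obtain ⟨n, hn, hn1, hn2⟩ := (hmem _ _ _).1 (h6 x hx y hy hxy (U', V', N))
  exact ⟨n, hn, hU'' hn1, hV'' hn2⟩

end IntervalDynamics

theorem corollary11 (I : Set ℝ) (hI : I.OrdConnected) (hne : I.Nontrivial)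
    (f : I → I) (hf : Continuous f) (hsurj : Function.Surjective f)
    (hbi : IntervalDynamics.IsBitransitive f) :
    ∃ g : I → I, Continuous g ∧ IntervalDynamics.TopConjugate f g ∧
      IntervalDynamics.IsExtremelyChaoticAE g := by
  have hnt : Nontrivial I := hne.coe_sort
  have hpol : PolishSpace I := IntervalDynamics.polishSpace_of_isLocallyClosed
    (IntervalDynamics.isLocallyClosed_of_ordConnected hI)
  -- The conditionally complete order on `I` needs a default value for suprema not attained in `I`;
  -- any point serves.
  let _ : Inhabited I := Classical.inhabited_of_nonempty inferInstance
  obtain ⟨μ, S, hμ, hdiff, hpos, hS, hμS, hpairs⟩ := hbi.exists_measure_hasDensePairs hf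
  obtain ⟨h, hh⟩ := IntervalDynamics.exists_homeomorph_null_image hI hne μ
  have hsemi : Function.Semiconj h f (h ∘ f ∘ h.symm) := fun x => by simp
  refine ⟨h ∘ f ∘ h.symm, h.continuous.comp (hf.comp h.symm.continuous), ⟨h, hsemi⟩, h '' S,
    (hpairs.image h hsemi).isExtremelyScrambled hI (hS.image h.injective), ?_⟩
  refine measure_mono_null ?_ (hh Sᶜ hμS)
  rintro y ⟨hy, hyS⟩
  refine ⟨h.symm ⟨y, hy⟩, fun hmem => hyS ⟨⟨y, hy⟩, ⟨_, hmem, by simp⟩, rfl⟩, by simp⟩
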